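/- Let $\mathbb I$ be the cube category without connections: its objects are the cubes $I^m$, $m\ge 0$, with $I=\{0<1\}$, and its morphisms are generated by the elementary faces $\alpha_i^{\iota}\colon I^{m-1}\to I^m$ (insert the constant $\iota\in\{0,1\}$ as $i$-th coordinate) and the elementary degeneracies $\beta_i\colon I^m\to I^{m-1}$ (delete the $i$-th coordinate). A cubical set is a functor $X\colon\mathbb I^{\mathrm{op}}\to\mathbf{Set}$; elements of $X_m=X(I^m)$ are called $m$-cubes, and $x\tau\in X_l$ denotes the image of $x\in X_m$ under $\tau\colon I^l\to I^m$. A cube $x \in X_m$ is degenerate if $x=y\varepsilon$ for some epimorphism $\varepsilon\colon I^m\to I^k$ with $k<m$ and some $y\in X_k$. A $k$-sphere in $X$ ($k\ge1$) is a family of $(k-1)$-cubes $c_i^{\iota}$ ($1\le i\le k$, $\iota\in\{0,1\}$) such that $c_j^{\iota}\alpha_i^{\upsilon}=c_i^{\upsilon}\alpha_{j-1}^{\iota}$ for all $i<j$ and all $\iota,\upsilon\in\{0,1\}$; a filler of it is a $k$-cube $w$ with $w\alpha_i^{\iota}=c_i^{\iota}$ for all $i$ and $\iota$. A level of a topos $\mathcal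 A$ is an essential subtopos, that is, a string of adjoint functors $i_!\dashv i^*\dashv i_*$ with $i^*\colon\mathcal A\to\mathcal B$ and $i_*$ (hence $i_!$) fully faithful. An object $X$ of $\mathcal A$ is skeletal for the level if $X\cong i_!i^*X$, and coskeletal if $X\cong i_*i^*X$. A level $\mathcal B'$ is lower than $\mathcal B$ if its inclusions $i'_!$ and $i'_*$ factor, up to isomorphism, through $i_!$ and $i_*$ respectively; it is way below $\mathcal B$ if in addition $i'_!$ factors through $i_*$ up to isomorphism. The Aufhebung of a level is the smallest level, with respect to the relation "lower than", that it is way below. The level $n$ of the topos of cubical sets is given by restriction to the full subcategory of $\mathbb I$ on $I^0,\dots,I^n$ together with left and right Kan extension; objects that are skeletal (coskeletal) for it are called $n$-skeletal ($n$-coskeletal). **Theorem.** Let $n\ge 1$. 1. The Aufhebung of the level $n$ of the topos of cubical sets is the level $2n$. 2. In particular, every $n$-skeletal cubical set is $2n$-coskeletal. 3. The bound is sharp: there is an $n$-skeletal cubical set $X$ which is not $(2n-1)$-coskeletal and which has exactly three nondegenerate cubes, namely one vertex $v$ and two different $n$-cubes $x$ and $y$, such that for all $m<n$ and all $\tau\colon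 I^m\to I^n$ both $x\tau$ and $y\tau$ are equal to the $m$-cube $v\pi$, where $\pi\colon I^m\to I^0$ is the unique morphism. In this $X$ the family $$c_i^{\iota}=\begin{cases} x\beta_1\cdots\beta_{n-1} & 1\le i\le n,\\ y\beta_{n+1}\cdots\beta_{2n-1} & n<i\le 2n,\end{cases}$$ where $\beta_1\cdots\beta_{n-1}$ and $\beta_{n+1}\cdots\beta_{2n-1}$ denote the projections $I^{2n-1}\to I^n$ onto the last $n$ and onto the first $n$ coordinates respectively, is a $2n$-sphere without a filler. -/

import Mathlib

open CategoryTheory Opposite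

universe u v

/-! ## Levels (essential subtoposes) of a topos -/

/-- A level of a category `A` (in practice a topos): a category `B` with adjoint functors
`shriek ⊣ restr ⊣ star`, where `star : B ⥤ A` (hence also `shriek : B ⥤ A`) is fully faithful.
Since `restr` has a left adjoint it preserves all limits, so `star` is the direct image of a
geometric inclusion: this is exactly an essential subtopos when `A` is a topos. -/
structure Level (A : Type u) [Category.{v} A] where
  B : Type u
  [cat : Category.{v} B]
  /-- `i_!`, the skeletal inclusion -/
  shriek : B ⥤ A
  /-- `i^*` -/
  restr : A ⥤ B
  /-- `i_*`, the coskeletal inclusion -/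
  star : B ⥤ A
  adjShriek : shriek ⊣ restr
  adjStar : restr ⊣ star
  full : star.Full
  faithful : star.Faithful

attribute [instance] Level.cat Level.full Level.faithful

namespace Level

variable {A : Type u} [Category.{v} A]

/-- The comonad `i_! i^*`, as a functor. -/
def sk (L : Level A) : A ⥤ A := L.restr ⋙ L.shriek

/-- The monad `i_* i^*`, as a functor. -/
def cosk (L : Level A) : A ⥤ A := L.restr ⋙ L.star

def IsSkeletal (L : Level A) (X : A) : Prop := Nonempty (X ≅ L.sk.obj X)

def IsCoskeletal (L : Level A) (X : A) : Prop := Nonempty (X ≅ L.cosk.obj X)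

/-- `L` is lower than `M`: the skeletal and the coskeletal inclusions of `L` factor, up to
isomorphism, through the skeletal and the coskeletal inclusions of `M` respectively. -/
def IsLower (L M : Level A) : Prop :=
  (∃ F : L.B ⥤ M.B, Nonempty (F ⋙ M.shriek ≅ L.shriek)) ∧
  (∃ G : L.B ⥤ M.B, Nonempty (G ⋙ M.star ≅ L.star))

/-- `L` is way below `M`: it is lower, and moreover the skeletal inclusion of `L` factors through
the coskeletal inclusion of `M`. -/
def IsWayBelow (L M : Level A) : Prop :=
  L.IsLower M ∧ ∃ F : L.B ⥤ M.B, Nonempty (F ⋙ M.star ≅ L.shriek)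

/-- `M` is the Aufhebung of `L`: the smallest among all levels that `L` is way below. -/
def IsAufhebung (L M : Level A) : Prop :=
  L.IsWayBelow M ∧ ∀ M' : Level A, L.IsWayBelow M' → M.IsLower M'

end Level

/-! ## The cube category -/

/-- The cube category (no connections, symmetries or diagonals); the object `⟨n⟩` is `I^n`. -/
structure CubeCat where
  dim : ℕ

namespace CubeCat

/-- A morphism `I^m ⟶ I^n`, written in coordinates: the `j`-th coordinate of the image of a point
`t` is the coordinate `t i` if `coord j = inl i`, and the constant `b` if `coord j = inr b`
(`false` is the end point `0`, and `true` the end point `1`); the coordinates of `t` that are used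
occur in their original order and without repetition. Theorem `CubeCat.generated` below shows
that these are precisely the composites of the elementary faces and degeneracies. -/
@[ext]
structure Hom (m n : CubeCat) where
  coord : Fin n.dim → Fin m.dim ⊕ Bool
  mono : ∀ ⦃j j' : Fin n.dim⦄ ⦃i i' : Fin m.dim⦄, j < j' →
    coord j = Sum.inl i → coord j' = Sum.inl i' → i < i'

/-- The map on points of the cubes. -/
def Hom.eval {m n : CubeCat} (f : Hom m n) (t : Fin m.dim → Bool) : Fin n.dim → Bool :=
  fun j => Sum.elim t id (f.coord j)

def Hom.id (m : CubeCat) : Hom m m where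
  coord := Sum.inl
  mono j j' i i' h h1 h2 := by
    cases h1; cases h2; exact h

def Hom.comp {l m n : CubeCat} (f : Hom l m) (g : Hom m n) : Hom l n where
  coord j := Sum.elim f.coord Sum.inr (g.coord j)
  mono j j' i i' h h1 h2 := by
    rcases e1 : g.coord j with a | a <;> rcases e2 : g.coord j' with a' | a' <;>
      simp only [e1, e2, Sum.elim_inl, Sum.elim_inr, reduceCtorEq] at h1 h2
    exact f.mono (g.mono h e1 e2) h1 h2

instance : Category CubeCat where
  Hom := Hom
  id := Hom.id
  comp := Hom.comp
  id_comp f := by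
    apply Hom.ext; funext j
    change Sum.elim Sum.inl Sum.inr (f.coord j) = f.coord j
    cases f.coord j <;> rfl
  comp_id f := by
    apply Hom.ext; funext j; rfl
  assoc f g h := by
    apply Hom.ext; funext j
    change Sum.elim (Hom.comp f g).coord Sum.inr (h.coord j) =
      Sum.elim f.coord Sum.inr (Sum.elim g.coord Sum.inr (h.coord j))
    cases h.coord j <;> rfl

theorem eval_id {m : CubeCat} (t : Fin m.dim → Bool) : Hom.eval (𝟙 m) t = t := rfl

theorem eval_comp {l m n : CubeCat} (f : l ⟶ m) (g : m ⟶ n) (t : Fin l.dim → Bool) :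
    Hom.eval (f ≫ g) t = Hom.eval g (Hom.eval f t) := by
  funext j
  change Sum.elim t id (Sum.elim f.coord Sum.inr (g.coord j)) =
    Sum.elim (Hom.eval f t) id (g.coord j)
  cases g.coord j <;> rfl

/-- A morphism is determined by its map on points. -/
theorem eval_injective {m n : CubeCat} (f g : m ⟶ n) (h : Hom.eval f = Hom.eval g) : f = g := by
  apply Hom.ext; funext j
  have h0 : ∀ t : Fin m.dim → Bool, Sum.elim t id (f.coord j) = Sum.elim t id (g.coord j) :=
    fun t => congrFun (congrFun h t) j
  rcases e1 : f.coord j with a | a <;> rcases e2 : g.coord j with b | b <;>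
    simp only [e1, e2, Sum.elim_inl, Sum.elim_inr, id] at h0
  · have := h0 (fun i => decide (i = a))
    simp at this
    rw [this]
  · have := h0 (fun _ => !b)
    simp at this
  · have := h0 (fun _ => !a)
    simp at this
  · have := h0 (fun _ => true)
    rw [this]

/-- The elementary face `I^n ⟶ I^(n+1)` inserting the constant `ε` at position `i`. -/
def face {n : ℕ} (i : Fin (n + 1)) (ε : Bool) : (⟨n⟩ : CubeCat) ⟶ ⟨n + 1⟩ where
  coord := i.insertNth (α := fun _ => Fin n ⊕ Bool) (Sum.inr ε) Sum.inl
  mono j j' a a' h h1 h2 := by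
    induction j using i.succAboveCases <;> induction j' using i.succAboveCases <;>
      simp_all

/-- The elementary degeneracy `I^(n+1) ⟶ I^n` deleting the coordinate `i`. -/
def degen {n : ℕ} (i : Fin (n + 1)) : (⟨n + 1⟩ : CubeCat) ⟶ ⟨n⟩ where
  coord j := Sum.inl (i.succAbove j)
  mono j j' a a' h h1 h2 := by
    cases h1; cases h2; exact Fin.strictMono_succAbove i h

/-- The projection `I^m ⟶ I^n` on the first `n` coordinates. -/
def firstCoords {m n : ℕ} (h : n ≤ m) : (⟨m⟩ : CubeCat) ⟶ ⟨n⟩ where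
  coord j := Sum.inl (Fin.castLE h j)
  mono j j' a a' hj h1 h2 := by
    cases h1; cases h2; exact hj

/-- The projection `I^m ⟶ I^n` on the last `n` coordinates. -/
def lastCoords {m n : ℕ} (h : n ≤ m) : (⟨m⟩ : CubeCat) ⟶ ⟨n⟩ where
  coord j := Sum.inl ⟨m - n + j.val, by have := j.isLt; dsimp only at this ⊢; omega⟩
  mono j j' a a' hj h1 h2 := by
    cases h1; cases h2; exact Nat.add_lt_add_left hj _

/-- The morphisms generated by the elementary faces and degeneracies. -/
inductive Generated : ∀ {m n : CubeCat}, (m ⟶ n) → Prop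
  | id (m : CubeCat) : Generated (𝟙 m)
  | face {m : CubeCat} {n : ℕ} (f : m ⟶ ⟨n⟩) (i : Fin (n + 1)) (ε : Bool) :
      Generated f → Generated (f ≫ face i ε)
  | degen {m : ℕ} {n : CubeCat} (i : Fin (m + 1)) (f : (⟨m⟩ : CubeCat) ⟶ n) :
      Generated f → Generated (degen i ≫ f)

/-- Every morphism of the cube category is a composite of elementary faces and degeneracies. -/
theorem generated {m n : CubeCat} (f : m ⟶ n) : Generated f := by
  obtain ⟨m⟩ := m
  obtain ⟨n⟩ := n
  induction hN : m + n using Nat.strong_induction_on generalizing m n with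
  | _ N ih =>
  by_cases hc : ∃ j b, f.coord j = Sum.inr b
  · obtain ⟨j, b, hj⟩ := hc
    cases n with
    | zero => exact j.elim0
    | succ n =>
      let g : (⟨m⟩ : CubeCat) ⟶ ⟨n⟩ :=
        { coord := fun k => f.coord (Fin.succAbove j k)
          mono := fun k k' a a' h h1 h2 => f.mono (Fin.strictMono_succAbove j h) h1 h2 }
      have e : f = g ≫ CubeCat.face j b := by
        apply Hom.ext; funext k
        change f.coord k = Sum.elim g.coord Sum.inr
          (Fin.insertNth (α := fun _ => Fin n ⊕ Bool) j (Sum.inr b) Sum.inl k)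
        induction k using Fin.succAboveCases j with
        | x => simpa using hj
        | p k => simp [g]
      rw [e]
      exact Generated.face g j b (ih (m + n) (by omega) m n g rfl)
  · push Not at hc
    have hl : ∀ j, ∃ i, f.coord j = Sum.inl i := by
      intro j
      rcases e : f.coord j with i | b
      · exact ⟨i, rfl⟩
      · exact (hc j b e).elim
    choose p hp using hl
    have hpm : StrictMono p := fun j j' h => f.mono h (hp j) (hp j')
    by_cases hs : Function.Surjective p
    · have hmn : n = m := by
        simpa using Fintype.card_congr (Equiv.ofBijective p ⟨hpm.injective, hs⟩)
      subst hmn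
      have hid : ∀ j, p j = j := by
        intro j
        have : (hpm.orderIsoOfSurjective p hs) = OrderIso.refl _ := Subsingleton.elim _ _
        exact congrArg (fun e : Fin n ≃o Fin n => e j) this
      have e : f = 𝟙 _ := by
        apply Hom.ext; funext j
        rw [hp, hid]; rfl
      rw [e]; exact Generated.id _
    · simp only [Function.Surjective, not_forall, not_exists] at hs
      obtain ⟨i, hi⟩ := hs
      cases m with
      | zero => exact i.elim0
      | succ m =>
        have hq : ∀ j, ∃ k, Fin.succAbove i k = p j := fun j => Fin.exists_succAbove_eq (hi j)
        choose q hq using hq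
        let g : (⟨m⟩ : CubeCat) ⟶ ⟨n⟩ :=
          { coord := fun j => Sum.inl (q j)
            mono := fun j j' a a' h h1 h2 => by
              cases h1; cases h2
              have := hpm h
              rw [← hq, ← hq] at this
              exact (Fin.strictMono_succAbove i).lt_iff_lt.mp this }
        have e : f = CubeCat.degen i ≫ g := by
          apply Hom.ext; funext j
          change f.coord j = Sum.inl (i.succAbove (q j))
          rw [hp, hq]
        rw [e]
        exact Generated.degen i g (ih (m + n) (by omega) m n g rfl)

end CubeCat

/-! ## Cubical sets -/

/-- The topos of cubical sets. -/
abbrev CubicalSet := CubeCatᵒᵖ ⥤ Type u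

namespace CubicalSet

/-- The set of `n`-cubes. -/
abbrev cubes (X : CubicalSet.{u}) (n : ℕ) : Type u := X.obj (op ⟨n⟩)

/-- The right action `x τ` of a morphism `τ : I^m ⟶ I^n` on an `n`-cube `x`. -/
def act {X : CubicalSet.{u}} {m n : ℕ} (x : X.cubes n) (τ : (⟨m⟩ : CubeCat) ⟶ ⟨n⟩) : X.cubes m :=
  X.map τ.op x

/-- An `n`-cube is degenerate if it is `y ε` for an epimorphism `ε : I^n ⟶ I^m` with `m < n`. -/
def IsDegenerate {X : CubicalSet.{u}} {n : ℕ} (x : X.cubes n) : Prop :=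
  ∃ (m : ℕ) (ε : (⟨n⟩ : CubeCat) ⟶ ⟨m⟩) (y : X.cubes m), m < n ∧ Epi ε ∧ x = act y ε

/-- The `k`-cubes `c i ι` (for `i < k + 1` and `ι = 0, 1`) are the faces of a `(k+1)`-sphere.
The indices `i < j` of the usual cycle equations are `i.castSucc < j.succ` here; there are no
equations for `k = 0`. -/
def IsSphere (X : CubicalSet.{u}) : (k : ℕ) → (Fin (k + 1) → Bool → X.cubes k) → Prop
  | 0, _ => True
  | k + 1, c => ∀ (i j : Fin (k + 1)), i ≤ j → ∀ ι υ : Bool,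
      act (c j.succ ι) (CubeCat.face (n := k) i υ) =
        act (c i.castSucc υ) (CubeCat.face (n := k) j ι)

/-- The `(k+1)`-cube `y` fills the sphere with faces `c`. -/
def IsFiller {X : CubicalSet.{u}} {k : ℕ} (c : Fin (k + 1) → Bool → X.cubes k)
    (y : X.cubes (k + 1)) : Prop :=
  ∀ (i : Fin (k + 1)) (ι : Bool), act y (CubeCat.face i ι) = c i ι

/-- The inclusion of the full subcategory on `I^0, …, I^n`. -/
abbrev truncIncl (n : ℕ) :
    ObjectProperty.FullSubcategory (fun I : CubeCat => I.dim ≤ n) ⥤ CubeCat :=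
  ObjectProperty.ι _

/-- The level `n` of the topos of cubical sets: presheaves on the full subcategory of the cube
category on `I^0, …, I^n`, with restriction and left and right Kan extension. -/
noncomputable def level (n : ℕ) : Level CubicalSet.{u} where
  B := (ObjectProperty.FullSubcategory (fun I : CubeCat => I.dim ≤ n))ᵒᵖ ⥤ Type u
  shriek := (truncIncl n).op.lan
  restr := (Functor.whiskeringLeft _ _ _).obj (truncIncl n).op
  star := (truncIncl n).op.ran
  adjShriek := (truncIncl n).op.lanAdjunction (Type u)
  adjStar := (truncIncl n).op.ranAdjunction (Type u)
  full := ((truncIncl n).op.ranAdjunction (Type u)).fullyFaithfulROfIsIsoCounit.full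
  faithful := ((truncIncl n).op.ranAdjunction (Type u)).fullyFaithfulROfIsIsoCounit.faithful

/-- A cubical set is `n`-skeletal. -/
def IsSkeletal (n : ℕ) (X : CubicalSet.{u}) : Prop := (level n).IsSkeletal X

/-- A cubical set is `n`-coskeletal. -/
def IsCoskeletal (n : ℕ) (X : CubicalSet.{u}) : Prop := (level n).IsCoskeletal X

end CubicalSet

/-!
All that has to be known about a level `L` is the class of morphisms that its restriction functor
`i^*` inverts: skeletal objects are left orthogonal, coskeletal objects right
orthogonal to this class (`Level.IsSkeletal.exists_lift`, `Level.IsCoskeletal.exists_extension`),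
and `L` is lower than `M` if it inverts everything that `M` inverts (`Level.isLower_of_inverts`).
The level `n` of cubical sets inverts the morphisms that are bijective in dimensions at most `n`.

*The upper bound.* A cube of an `n`-skeletal cubical set depends on at most `n` of its coordinates.
Let a sphere of dimension `m > 2n` be given. Among its faces choose one that depends on a set `D` of
coordinates of maximal size. Comparing codimension-two faces, and using that `D` and the
corresponding set of any other face together miss a coordinate, one finds that all faces depend on
coordinates in `D` only. A degeneracy of any face in a direction `i ∉ D` is then a filler
(`exists_faceOperators_eq`). Two cubes of dimension greater than `n` with the same faces agree
(`eq_of_faceOperators_eq`). By induction on the dimension, the unit from an `n`-skeletal cubical set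
to its `2n`-coskeleton is bijective (`CubicalSet.IsSkeletal.isCoskeletal`), so the level `n` is way
below the level `2n`.

*Sharpness.* `CubicalSet.twoCells n` consists of two `n`-cubes whose boundaries are collapsed to a
point. No cube of it has degeneracies of both `n`-cubes among its faces, so the `2n`-sphere whose
faces are degenerate `n`-cubes of both kinds has no filler. Phrased as a morphism from the boundary
of `I^(2n)`, this says that a level for which `twoCells n` is coskeletal cannot invert the inclusion
of the boundary of `I^(2n)`, whereas the level `2n - 1` does.

*Minimality.* Let `L` be any level and consider the counit from the skeleton of the representable
`I^(2n)` to `I^(2n)`. A morphism to `I^(2n)` outside of the boundary is a split epimorphism.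
Therefore either the image of the counit contains the identity, and `I^(2n)` is skeletal, or this
image lies in the boundary, and `i^*` inverts the inclusion of the boundary
(`CubicalSet.isSkeletal_or_isIso_restr_map_boundary_ι`). If the level `n` is way below `L`, then
`twoCells n` is coskeletal for `L`, which rules out the second case. In the first case all `I^k`
with `k ≤ 2n`, being retracts of `I^(2n)`, are skeletal for `L`, and the level `2n` is lower than
`L`.
-/

namespace Level

variable {A : Type u} [Category.{v} A]

/-! ### Levels of a category -/

instance (L : Level A) : L.shriek.Full :=
  ((Adjunction.Triple.mk L.adjShriek L.adjStar).fullyFaithfulEquiv.symm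
    (Functor.FullyFaithful.ofFullyFaithful L.star)).full

instance (L : Level A) : L.shriek.Faithful :=
  ((Adjunction.Triple.mk L.adjShriek L.adjStar).fullyFaithfulEquiv.symm
    (Functor.FullyFaithful.ofFullyFaithful L.star)).faithful

/-- The counit `i_! i^* X ⟶ X`. -/
def counit (L : Level A) (X : A) : L.shriek.obj (L.restr.obj X) ⟶ X :=
  L.adjShriek.counit.app X

/-- The unit `X ⟶ i_* i^* X`. -/
def unit (L : Level A) (X : A) : X ⟶ L.star.obj (L.restr.obj X) :=
  L.adjStar.unit.app X

theorem counit_naturality (L : Level A) {X Y : A} (f : X ⟶ Y) :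
    L.shriek.map (L.restr.map f) ≫ L.counit Y = L.counit X ≫ f :=
  L.adjShriek.counit_naturality f

theorem unit_naturality (L : Level A) {X Y : A} (f : X ⟶ Y) :
    L.unit X ≫ L.star.map (L.restr.map f) = f ≫ L.unit Y :=
  (L.adjStar.unit_naturality f)

instance isIso_restr_counit (L : Level A) (X : A) : IsIso (L.restr.map (L.counit X)) := by
  have h : L.adjShriek.unit.app (L.restr.obj X) ≫ L.restr.map (L.counit X) = 𝟙 _ :=
    L.adjShriek.right_triangle_components X
  have : IsIso (L.adjShriek.unit.app (L.restr.obj X)) := inferInstance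
  exact (IsIso.eq_inv_of_hom_inv_id h) ▸ inferInstance

instance isIso_restr_unit (L : Level A) (X : A) : IsIso (L.restr.map (L.unit X)) := by
  have h : L.restr.map (L.unit X) ≫ L.adjStar.counit.app (L.restr.obj X) = 𝟙 _ :=
    L.adjStar.left_triangle_components X
  have : IsIso (L.adjStar.counit.app (L.restr.obj X)) := inferInstance
  exact (IsIso.eq_inv_of_inv_hom_id h) ▸ inferInstance

instance (L : Level A) (C : L.B) : IsIso (L.counit (L.shriek.obj C)) :=
  inferInstanceAs (IsIso (L.adjShriek.counit.app (L.shriek.obj C)))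

instance (L : Level A) (C : L.B) : IsIso (L.unit (L.star.obj C)) :=
  inferInstanceAs (IsIso (L.adjStar.unit.app (L.star.obj C)))

theorem IsSkeletal.isIso_counit {L : Level A} {X : A} (h : L.IsSkeletal X) :
    IsIso (L.counit X) :=
  L.adjShriek.isIso_counit_app_of_iso h.some

theorem IsCoskeletal.isIso_unit {L : Level A} {X : A} (h : L.IsCoskeletal X) :
    IsIso (L.unit X) :=
  L.adjStar.isIso_unit_app_of_iso h.some

theorem isSkeletal_of_isIso_counit {L : Level A} {X : A}
    (_ : IsIso (L.counit X)) : L.IsSkeletal X :=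
  ⟨(asIso (L.counit X)).symm⟩

theorem isCoskeletal_of_isIso_unit {L : Level A} {X : A}
    (_ : IsIso (L.unit X)) : L.IsCoskeletal X :=
  ⟨(asIso (L.unit X) : X ≅ L.star.obj (L.restr.obj X))⟩

theorem isSkeletal_shriek (L : Level A) (C : L.B) : L.IsSkeletal (L.shriek.obj C) :=
  isSkeletal_of_isIso_counit inferInstance

theorem isCoskeletal_star (L : Level A) (C : L.B) : L.IsCoskeletal (L.star.obj C) :=
  isCoskeletal_of_isIso_unit inferInstance

/-- Skeletal objects are left orthogonal to the morphisms inverted by `restr`: existence. -/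
theorem IsSkeletal.exists_lift {L : Level A} {X Y Z : A} (hX : L.IsSkeletal X) (f : Y ⟶ Z)
    (_ : IsIso (L.restr.map f)) (g : X ⟶ Z) : ∃ h : X ⟶ Y, h ≫ f = g := by
  have := hX.isIso_counit
  refine ⟨inv (L.counit X) ≫
    L.shriek.map (L.restr.map g ≫ inv (L.restr.map f)) ≫ L.counit Y, ?_⟩
  rw [Category.assoc, Category.assoc, IsIso.inv_comp_eq, ← L.counit_naturality,
    ← L.counit_naturality, ← Functor.map_comp_assoc]
  simp

/-- Skeletal objects are left orthogonal to the morphisms inverted by `restr`: uniqueness. -/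
theorem IsSkeletal.hom_ext {L : Level A} {X Y Z : A} (hX : L.IsSkeletal X) (f : Y ⟶ Z)
    (_ : IsIso (L.restr.map f)) {h h' : X ⟶ Y} (e : h ≫ f = h' ≫ f) : h = h' := by
  have := hX.isIso_counit
  have e' : L.restr.map h = L.restr.map h' := by
    rw [← cancel_mono (L.restr.map f), ← Functor.map_comp, e, Functor.map_comp]
  rw [← cancel_epi (L.counit X), ← L.counit_naturality, e',
    L.counit_naturality]

/-- Coskeletal objects are right orthogonal to the morphisms inverted by `restr`: existence. -/
theorem IsCoskeletal.exists_extension {L : Level A} {X Y Z : A} (hX : L.IsCoskeletal X)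
    (f : Y ⟶ Z) (_ : IsIso (L.restr.map f)) (g : Y ⟶ X) : ∃ h : Z ⟶ X, f ≫ h = g := by
  have := hX.isIso_unit
  refine ⟨L.unit Z ≫ L.star.map (inv (L.restr.map f) ≫ L.restr.map g) ≫
    inv (L.unit X), ?_⟩
  rw [← Category.assoc, ← Category.assoc, IsIso.comp_inv_eq, ← L.unit_naturality,
    ← L.unit_naturality, Category.assoc, ← Functor.map_comp]
  simp

/-- Coskeletal objects are right orthogonal to the morphisms inverted by `restr`: uniqueness. -/
theorem IsCoskeletal.hom_ext {L : Level A} {X Y Z : A} (hX : L.IsCoskeletal X)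
    (f : Y ⟶ Z) (_ : IsIso (L.restr.map f)) {h h' : Z ⟶ X} (e : f ≫ h = f ≫ h') : h = h' := by
  have := hX.isIso_unit
  have e' : L.restr.map h = L.restr.map h' := by
    rw [← cancel_epi (L.restr.map f), ← Functor.map_comp, e, Functor.map_comp]
  rw [← cancel_mono (L.unit X), ← L.unit_naturality, e',
    L.unit_naturality]

/-- An object is skeletal as soon as the counit `i_! i^* X ⟶ X` has a section. -/
theorem isSkeletal_of_section {L : Level A} {X : A} (s : X ⟶ L.shriek.obj (L.restr.obj X))
    (hs : s ≫ L.counit X = 𝟙 X) : L.IsSkeletal X := by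
  refine isSkeletal_of_isIso_counit ⟨s, ?_, hs⟩
  refine (L.isSkeletal_shriek (L.restr.obj X)).hom_ext (L.counit X) inferInstance ?_
  rw [Category.assoc, hs, Category.id_comp, Category.comp_id]

theorem IsSkeletal.of_retract {L : Level A} {X Y : A} (hY : L.IsSkeletal Y) (i : X ⟶ Y)
    (r : Y ⟶ X) (h : i ≫ r = 𝟙 X) : L.IsSkeletal X := by
  have := hY.isIso_counit
  refine isSkeletal_of_section (i ≫ inv (L.counit Y) ≫ L.shriek.map (L.restr.map r)) ?_
  rw [Category.assoc, Category.assoc, counit_naturality, IsIso.inv_hom_id_assoc, h]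

theorem IsCoskeletal.of_iso {L : Level A} {X Y : A} (hY : L.IsCoskeletal Y) (e : X ≅ Y) :
    L.IsCoskeletal X :=
  ⟨e ≪≫ hY.some ≪≫ (L.cosk.mapIso e).symm⟩

/-- If `i^*` of the level `L` inverts the counit of `M` at an `L`-skeletal object, then this object
is `M`-skeletal. -/
theorem IsSkeletal.of_isIso_restr_counit {L M : Level A} {X : A} (hX : L.IsSkeletal X)
    (h : IsIso (L.restr.map (M.counit X))) : M.IsSkeletal X := by
  obtain ⟨s, hs⟩ := hX.exists_lift _ h (𝟙 X)
  exact isSkeletal_of_section s hs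

theorem IsCoskeletal.of_isIso_restr_unit {L M : Level A} {X : A} (hX : L.IsCoskeletal X)
    (h : IsIso (L.restr.map (M.unit X))) : M.IsCoskeletal X := by
  obtain ⟨r, hr⟩ := hX.exists_extension _ h (𝟙 X)
  refine isCoskeletal_of_isIso_unit ⟨r, hr, ?_⟩
  refine (M.isCoskeletal_star (M.restr.obj X)).hom_ext (M.unit X) inferInstance ?_
  rw [← Category.assoc, hr, Category.id_comp, Category.comp_id]

theorem exists_comp_star_iso {B : Type*} [Category* B] {M : Level A} (F : B ⥤ A)
    (h : ∀ C, M.IsCoskeletal (F.obj C)) : ∃ G : B ⥤ M.B, Nonempty (G ⋙ M.star ≅ F) := by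
  have (C : B) : IsIso (M.unit (F.obj C)) := (h C).isIso_unit
  exact ⟨F ⋙ M.restr, ⟨(NatIso.ofComponents (fun C => asIso (M.unit (F.obj C)))
    (fun f => (M.unit_naturality (F.map f)).symm)).symm⟩⟩

theorem exists_comp_shriek_iso {B : Type*} [Category* B] {M : Level A} (F : B ⥤ A)
    (h : ∀ C, M.IsSkeletal (F.obj C)) : ∃ G : B ⥤ M.B, Nonempty (G ⋙ M.shriek ≅ F) := by
  have (C : B) : IsIso (M.counit (F.obj C)) := (h C).isIso_counit
  exact ⟨F ⋙ M.restr, ⟨NatIso.ofComponents (fun C => asIso (M.counit (F.obj C)))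
    (fun f => M.counit_naturality (F.map f))⟩⟩

/-- A level is determined by the class of morphisms that `i^*` inverts, and the order of levels is
the reverse inclusion of these classes. -/
theorem isLower_of_inverts {L M : Level A}
    (h : ∀ ⦃X Y : A⦄ (f : X ⟶ Y), IsIso (M.restr.map f) → IsIso (L.restr.map f)) :
    L.IsLower M :=
  ⟨exists_comp_shriek_iso _ fun C =>
      (L.isSkeletal_shriek C).of_isIso_restr_counit (h _ inferInstance),
    exists_comp_star_iso _ fun C =>
      (L.isCoskeletal_star C).of_isIso_restr_unit (h _ inferInstance)⟩

/-- If `L` is way below `M`, then every `L`-skeletal object is `M`-coskeletal. -/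
theorem IsWayBelow.isCoskeletal {L M : Level A} (h : L.IsWayBelow M) {X : A}
    (hX : L.IsSkeletal X) : M.IsCoskeletal X := by
  obtain ⟨-, F, ⟨e⟩⟩ := h
  exact (M.isCoskeletal_star (F.obj (L.restr.obj X))).of_iso
    (hX.some ≪≫ (e.app (L.restr.obj X)).symm)

end Level

/-! ### Filling spheres in terms of face-degeneracy operators -/

theorem Fin.exists_notMem_of_card_lt {m : ℕ} (D : Finset (Fin m)) (h : D.card < m) :
    ∃ i, i ∉ D := by
  by_contra! hD
  rw [Finset.eq_univ_iff_forall.mpr hD, Finset.card_univ, Fintype.card_fin] at h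
  exact h.false

/-- Two elements which do not depend on all of their coordinates agree as soon as their faces
do. -/
theorem eq_of_faceOperators_eq {S : Type*} {m : ℕ} {E : Fin m → Bool → S → S}
    (hcomm : ∀ ⦃i j⦄, i ≠ j → ∀ ι υ x, E i ι (E j υ x) = E j υ (E i ι x))
    {x y : S} (h : ∀ i ι, E i ι x = E i ι y)
    (hx : ∃ i, ∀ ι, E i ι x = x) (hy : ∃ i, ∀ ι, E i ι y = y) : x = y := by
  obtain ⟨i, hi⟩ := hx
  obtain ⟨j, hj⟩ := hy
  by_cases hij : i = j
  · subst hij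
    rw [← hi true, h, hj]
  · rw [← hi true, h, ← hj true, hcomm hij, ← h i, hi, h]

/-- Let `E i ι` be operators which behave like taking first the face `(i, ι)`, then the degeneracy
`i`, on the set of `m`-cubes of a cubical set, and suppose that every element depends on at most `n`
coordinates, where `2 * n < m`. Then a compatible family `d` has a filler. -/
theorem exists_faceOperators_eq {S : Type*} {m n : ℕ} (hn : 1 ≤ n) (hm : 2 * n < m)
    {E : Fin m → Bool → S → S}
    (hself : ∀ i ι υ x, E i ι (E i υ x) = E i υ x)
    (hcomm : ∀ ⦃i j⦄, i ≠ j → ∀ ι υ x, E i ι (E j υ x) = E j υ (E i ι x))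
    (hdim : ∀ x, ∃ D : Finset (Fin m), D.card ≤ n ∧ ∀ i ∉ D, ∀ ι, E i ι x = x)
    (d : Fin m → Bool → S) (hd : ∀ i ι υ, E i ι (d i υ) = d i υ)
    (hdd : ∀ ⦃i j⦄, i ≠ j → ∀ ι υ, E i ι (d j υ) = E j υ (d i ι)) :
    ∃ w, ∀ i ι, E i ι w = d i ι := by
  classical
  -- `D x` is the set of coordinates on which `x` depends.
  let D (x : S) : Finset (Fin m) := {i | E i false x ≠ x}
  have mem_D (x : S) (i : Fin m) : i ∈ D x ↔ E i false x ≠ x := by simp [D]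
  have eq_of_notMem {x : S} {i : Fin m} (h : i ∉ D x) (ι : Bool) : E i ι x = x := by
    rw [mem_D, not_not] at h
    rw [← h, hself]
  have card_D (x : S) : (D x).card ≤ n := by
    obtain ⟨D', hc, h⟩ := hdim x
    refine (Finset.card_le_card fun i hi => ?_).trans hc
    by_contra hi'
    exact (mem_D x i).mp hi (h i hi' false)
  have self_notMem (j : Fin m) (υ : Bool) : j ∉ D (d j υ) := by
    rw [mem_D, not_not]; exact hd _ _ _
  have subset {i j : Fin m} (hij : i ≠ j) {υ : Bool} (h : i ∉ D (d j υ)) (ι : Bool) :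
      D (d j υ) ⊆ D (d i ι) := by
    intro k hk
    by_contra hk'
    have hkj : k ≠ j := fun e => self_notMem j υ (e ▸ hk)
    refine (mem_D _ _).mp hk ?_
    rw [← eq_of_notMem h ι, hdd hij, hcomm hkj, eq_of_notMem hk']
  have hm0 : 0 < m := by omega
  have : Nonempty (Fin m × Bool) := ⟨⟨⟨0, hm0⟩, true⟩⟩
  -- A face depending on a maximal number of coordinates.
  obtain ⟨⟨j, υ⟩, hmax⟩ := Finite.exists_max fun p : Fin m × Bool => (D (d p.1 p.2)).card
  have hcard := card_D (d j υ)
  have exists_ne (i : Fin m) : ∃ k ∉ D (d j υ), k ≠ i := by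
    obtain ⟨k, hk⟩ := Fin.exists_notMem_of_card_lt (insert i (D (d j υ)))
      (by have := Finset.card_insert_le i (D (d j υ)); omega)
    rw [Finset.mem_insert, not_or] at hk
    exact ⟨k, hk.2, hk.1⟩
  have eq_max {i : Fin m} {ι : Bool} (h : D (d j υ) ⊆ D (d i ι)) : D (d i ι) = D (d j υ) :=
    (Finset.eq_of_subset_of_card_le h (hmax (i, ι))).symm
  have eq_of_ne {i : Fin m} (hi : i ∉ D (d j υ)) (hij : i ≠ j) (ι : Bool) :
      D (d i ι) = D (d j υ) := eq_max (subset hij hi ι)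
  have eq_D {i : Fin m} (hi : i ∉ D (d j υ)) (ι : Bool) : D (d i ι) = D (d j υ) := by
    by_cases hij : i = j
    · subst hij
      obtain ⟨k, hk, hki⟩ := exists_ne i
      have hk' := eq_of_ne hk hki true
      refine eq_max (hk' ▸ subset hki.symm ?_ ι)
      rwa [hk']
    · exact eq_of_ne hi hij ι
  have subset_D (k : Fin m) (ι : Bool) : D (d k ι) ⊆ D (d j υ) := by
    obtain ⟨i, hi⟩ := Fin.exists_notMem_of_card_lt (D (d j υ) ∪ D (d k ι))
      (by have := Finset.card_union_le (D (d j υ)) (D (d k ι))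
          have := card_D (d k ι)
          omega)
    rw [Finset.mem_union, not_or] at hi
    by_cases hik : i = k
    · exact (eq_D (hik ▸ hi.1) ι).subset
    · exact (subset hik hi.2 true).trans (eq_D hi.1 true).subset
  -- No face depends on the coordinate `i`, so the degeneracy of any face `(i, ι)` is a filler.
  obtain ⟨i, hi, -⟩ := exists_ne j
  have hface {k : Fin m} (hk : k ≠ i) (ι κ : Bool) : E k ι (d i κ) = d k ι := by
    rw [hdd hk, eq_of_notMem fun h => hi (subset_D _ _ h)]
  refine ⟨d i false, fun k ι => ?_⟩
  by_cases hk : k = i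
  · subst hk
    obtain ⟨l, hl, hlk⟩ := exists_ne k
    have hl' (κ : Bool) : E l true (d k κ) = d k κ := eq_of_notMem (fun h => hl (subset_D _ _ h)) _
    rw [hd, ← hl', hface hlk, ← hl', hface hlk]
  · exact hface hk _ _

/-! ### Morphisms of cubes -/

namespace CubeCat

theorem comp_coord {l m n : CubeCat} (f : l ⟶ m) (g : m ⟶ n) (j : Fin n.dim) :
    (f ≫ g).coord j = Sum.elim f.coord Sum.inr (g.coord j) := rfl

theorem comp_coord_of_inl {l m n : CubeCat} (f : l ⟶ m) {g : m ⟶ n} {j : Fin n.dim}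
    {i : Fin m.dim} (h : g.coord j = Sum.inl i) : (f ≫ g).coord j = f.coord i := by
  rw [comp_coord, h]; rfl

theorem comp_coord_of_inr {l m n : CubeCat} (f : l ⟶ m) {g : m ⟶ n} {j : Fin n.dim}
    {b : Bool} (h : g.coord j = Sum.inr b) : (f ≫ g).coord j = Sum.inr b := by
  rw [comp_coord, h]; rfl

/-- A morphism is a projection if none of its coordinates is constant. -/
def IsProjection {m n : CubeCat} (f : m ⟶ n) : Prop :=
  ∀ j, ∃ i, f.coord j = Sum.inl i

theorem not_isProjection_iff {m n : CubeCat} {f : m ⟶ n} :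
    ¬ IsProjection f ↔ ∃ j b, f.coord j = Sum.inr b := by
  rw [IsProjection, not_forall]
  refine exists_congr fun j => ?_
  cases f.coord j <;> simp

theorem IsProjection.of_comp {l m n : CubeCat} {f : l ⟶ m} {g : m ⟶ n}
    (h : IsProjection (f ≫ g)) : IsProjection g := by
  by_contra hg
  obtain ⟨j, b, hj⟩ := not_isProjection_iff.mp hg
  exact not_isProjection_iff.mpr ⟨j, b, comp_coord_of_inr f hj⟩ h

theorem isProjection_id (m : CubeCat) : IsProjection (𝟙 m) := fun j => ⟨j, rfl⟩

theorem isProjection_firstCoords {m n : ℕ} (h : n ≤ m) : IsProjection (firstCoords h) :=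
  fun _ => ⟨_, rfl⟩

theorem isProjection_lastCoords {m n : ℕ} (h : n ≤ m) : IsProjection (lastCoords h) :=
  fun _ => ⟨_, rfl⟩

theorem face_coord_self {n : ℕ} (i : Fin (n + 1)) (b : Bool) :
    (face i b).coord i = Sum.inr b :=
  Fin.insertNth_apply_same (α := fun _ => Fin n ⊕ Bool) i (Sum.inr b) Sum.inl

theorem not_isProjection_face {n : ℕ} (i : Fin (n + 1)) (b : Bool) :
    ¬ IsProjection (face i b) :=
  not_isProjection_iff.mpr ⟨i, b, face_coord_self i b⟩

/-- The strictly increasing map on coordinates that describes a projection. -/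
theorem IsProjection.exists_strictMono {m n : CubeCat} {f : m ⟶ n} (h : IsProjection f) :
    ∃ p : Fin n.dim → Fin m.dim, StrictMono p ∧ ∀ j, f.coord j = Sum.inl (p j) := by
  choose p hp using h
  exact ⟨p, fun j j' hj => f.mono hj (hp j) (hp j'), hp⟩

theorem IsProjection.dim_le {m n : CubeCat} {f : m ⟶ n} (h : IsProjection f) :
    n.dim ≤ m.dim := by
  obtain ⟨p, hp, -⟩ := h.exists_strictMono
  simpa using Fintype.card_le_of_injective p hp.injective

theorem IsProjection.eq_id {m : CubeCat} {f : m ⟶ m} (h : IsProjection f) : f = 𝟙 m := by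
  obtain ⟨p, hp, hf⟩ := h.exists_strictMono
  have hs : Function.Surjective p := Finite.surjective_of_injective hp.injective
  have hid : hp.orderIsoOfSurjective p hs = OrderIso.refl _ := Subsingleton.elim _ _
  apply Hom.ext
  funext j
  rw [hf j]
  exact congrArg (fun e : Fin m.dim ≃o Fin m.dim => (Sum.inl (e j) : Fin m.dim ⊕ Bool)) hid

theorem IsProjection.exists_section {m n : CubeCat} {f : m ⟶ n} (h : IsProjection f) :
    ∃ s : n ⟶ m, s ≫ f = 𝟙 n := by
  classical
  obtain ⟨p, hp, hf⟩ := h.exists_strictMono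
  let c (i : Fin m.dim) : Fin n.dim ⊕ Bool :=
    if hi : ∃ j, p j = i then Sum.inl hi.choose else Sum.inr false
  have hc {i : Fin m.dim} {j : Fin n.dim} (e : c i = Sum.inl j) : p j = i := by
    by_cases hi : ∃ j, p j = i
    · simp only [c, dif_pos hi, Sum.inl.injEq] at e
      exact e ▸ hi.choose_spec
    · simp [c, dif_neg hi] at e
  have hcp (j : Fin n.dim) : c (p j) = Sum.inl j := by
    have hi : ∃ j', p j' = p j := ⟨j, rfl⟩
    simp only [c, dif_pos hi, Sum.inl.injEq]
    exact hp.injective hi.choose_spec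
  refine ⟨⟨c, fun i i' j j' hi e e' => ?_⟩, ?_⟩
  · rw [← hc e, ← hc e'] at hi
    exact hp.lt_iff_lt.mp hi
  · apply Hom.ext
    funext j
    rw [comp_coord_of_inl _ (hf j)]
    exact hcp j

theorem IsProjection.epi {m n : CubeCat} {f : m ⟶ n} (h : IsProjection f) : Epi f := by
  obtain ⟨s, hs⟩ := h.exists_section
  exact (SplitEpi.mk s hs).epi

/-- The endomorphism of `I^m` replacing the `i`-th coordinate by the constant `b`. -/
def flatten {m : ℕ} (i : Fin m) (b : Bool) : (⟨m⟩ : CubeCat) ⟶ ⟨m⟩ where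
  coord j := if j = i then Sum.inr b else Sum.inl j
  mono j j' a a' hj h h' := by
    split_ifs at h h'
    cases h; cases h'; exact hj

theorem flatten_coord_self {m : ℕ} (i : Fin m) (b : Bool) :
    (flatten i b).coord i = Sum.inr b := if_pos rfl

theorem flatten_coord_of_ne {m : ℕ} {i j : Fin m} (h : j ≠ i) (b : Bool) :
    (flatten i b).coord j = Sum.inl j := if_neg h

theorem flatten_comp {m n : ℕ} {i : Fin m} {f : (⟨m⟩ : CubeCat) ⟶ ⟨n⟩}
    (h : ∀ j, f.coord j ≠ Sum.inl i) (b : Bool) : flatten i b ≫ f = f := by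
  apply Hom.ext
  funext j
  rcases e : f.coord j with k | c
  · rw [comp_coord_of_inl _ e, flatten_coord_of_ne]
    rintro rfl
    exact h j e
  · exact comp_coord_of_inr _ e

theorem comp_flatten {m n : ℕ} {i : Fin n} {b : Bool} {f : (⟨m⟩ : CubeCat) ⟶ ⟨n⟩}
    (h : f.coord i = Sum.inr b) : f ≫ flatten i b = f := by
  apply Hom.ext
  funext j
  by_cases hj : j = i
  · subst hj
    rw [comp_coord_of_inr f (flatten_coord_self j b), h]
  · exact comp_coord_of_inl f (flatten_coord_of_ne hj b)

theorem flatten_comp_flatten_self {m : ℕ} (i : Fin m) (b c : Bool) :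
    flatten i b ≫ flatten i c = flatten i c := by
  refine flatten_comp (fun j => ?_) b
  by_cases hj : j = i
  · subst hj; simp [flatten_coord_self]
  · simp [flatten_coord_of_ne hj, hj]

theorem flatten_comp_flatten {m : ℕ} {i j : Fin m} (h : i ≠ j) (b c : Bool) :
    flatten i b ≫ flatten j c = flatten j c ≫ flatten i b := by
  apply Hom.ext
  funext k
  simp only [comp_coord, flatten]
  by_cases hi : k = i <;> by_cases hj : k = j <;> simp_all

theorem flatten_eq_degen_comp_face {m : ℕ} (i : Fin (m + 1)) (b : Bool) :
    flatten i b = degen i ≫ face i b := by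
  apply Hom.ext
  funext k
  rw [comp_coord]
  change _ = Sum.elim _ _ (Fin.insertNth (α := fun _ => Fin m ⊕ Bool) i (Sum.inr b) Sum.inl k)
  induction k using Fin.succAboveCases i with
  | x => simp [flatten_coord_self]
  | p k => rw [flatten_coord_of_ne (Fin.succAbove_ne i k)]; simp [degen]

theorem exists_comp_face {m n : ℕ} {f : (⟨m⟩ : CubeCat) ⟶ ⟨n + 1⟩} (h : ¬ IsProjection f) :
    ∃ (i : Fin (n + 1)) (b : Bool) (g : (⟨m⟩ : CubeCat) ⟶ ⟨n⟩), f = g ≫ face i b := by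
  obtain ⟨i, b, hi⟩ := not_isProjection_iff.mp h
  refine ⟨i, b, f ≫ degen i, ?_⟩
  rw [Category.assoc, ← flatten_eq_degen_comp_face, comp_flatten hi]

end CubeCat

/-! ### Skeletal cubical sets are coskeletal -/

namespace CubicalSet

open CubeCat

theorem act_act {X : CubicalSet.{u}} {l m n : ℕ} (x : X.cubes n) (σ : (⟨m⟩ : CubeCat) ⟶ ⟨n⟩)
    (τ : (⟨l⟩ : CubeCat) ⟶ ⟨m⟩) : act (act x σ) τ = act x (τ ≫ σ) := by
  simp [act]

theorem act_id {X : CubicalSet.{u}} {n : ℕ} (x : X.cubes n) : act x (𝟙 _) = x := by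
  simp [act]

theorem app_act {X Y : CubicalSet.{u}} (f : X ⟶ Y) {m n : ℕ} (x : X.cubes n)
    (τ : (⟨m⟩ : CubeCat) ⟶ ⟨n⟩) : f.app (op ⟨m⟩) (act x τ) = act (f.app (op ⟨n⟩) x) τ :=
  NatTrans.naturality_apply f τ.op x

theorem hom_ext {X Y : CubicalSet.{u}} {f g : X ⟶ Y}
    (h : ∀ (m : ℕ) (x : X.cubes m), f.app (op ⟨m⟩) x = g.app (op ⟨m⟩) x) : f = g := by
  ext ⟨⟨m⟩⟩ x
  exact h m x

theorem isIso_iff_bijective {X Y : CubicalSet.{u}} (f : X ⟶ Y) :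
    IsIso f ↔ ∀ m : ℕ, Function.Bijective (f.app (op ⟨m⟩)) := by
  simp only [NatTrans.isIso_iff_isIso_app, CategoryTheory.isIso_iff_bijective]
  exact ⟨fun h m => h _, fun h m => h m.unop.dim⟩

theorem isIso_restr_map_iff {X Y : CubicalSet.{u}} (n : ℕ) (f : X ⟶ Y) :
    IsIso ((level.{u} n).restr.map f) ↔
      ∀ m ≤ n, Function.Bijective (f.app (op ⟨m⟩)) := by
  have e : IsIso ((level.{u} n).restr.map f) ↔
      ∀ m : (ObjectProperty.FullSubcategory (fun I : CubeCat => I.dim ≤ n))ᵒᵖ,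
        IsIso (f.app (op m.unop.obj)) := NatTrans.isIso_iff_isIso_app _
  simp only [e, CategoryTheory.isIso_iff_bijective]
  exact ⟨fun h m hm => h (op ⟨⟨m⟩, hm⟩), fun h m => h m.unop.obj.dim m.unop.property⟩

/-- The boundary of the representable cubical set `I^m`: the morphisms to `I^m` with a constant
coordinate. -/
def boundary (m : ℕ) : Subfunctor (uliftYoneda.{u}.obj (⟨m⟩ : CubeCat)) where
  obj _ := {f | ¬ IsProjection f.down}
  map _ _ hf hτ := hf hτ.of_comp

theorem isIso_restr_map_boundary_ι {k m : ℕ} (h : k < m) :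
    IsIso ((level.{u} k).restr.map (boundary.{u} m).ι) := by
  refine (isIso_restr_map_iff _ _).mpr fun l hl => ⟨Subtype.val_injective, fun f => ?_⟩
  exact ⟨⟨f, fun hf => absurd (IsProjection.dim_le hf) (by simp; omega)⟩, rfl⟩

/-- The elements of an `n`-skeletal cubical set come from dimensions at most `n`. -/
theorem IsSkeletal.exists_act_eq {n : ℕ} {X : CubicalSet.{u}} (hX : X.IsSkeletal n) {m : ℕ}
    (x : X.cubes m) :
    ∃ k ≤ n, ∃ (z : X.cubes k) (f : (⟨m⟩ : CubeCat) ⟶ ⟨k⟩), act z f = x := by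
  -- `S` agrees with `X` in dimensions at most `n`, so `X` being skeletal, it is a retract of `S`.
  let S : Subfunctor X :=
    { obj := fun U => {x | ∃ k ≤ n, ∃ (z : X.cubes k) (f : (⟨U.unop.dim⟩ : CubeCat) ⟶ ⟨k⟩),
        act z f = x}
      map := by
        rintro U V τ _ ⟨k, hk, z, f, rfl⟩
        exact ⟨k, hk, z, τ.unop ≫ f, (act_act z f τ.unop).symm⟩ }
  have hS : IsIso ((level.{u} n).restr.map S.ι) :=
    (isIso_restr_map_iff _ _).mpr fun k hk => ⟨Subtype.val_injective, fun z =>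
      ⟨⟨z, k, hk, z, 𝟙 _, act_id _⟩, rfl⟩⟩
  obtain ⟨s, hs⟩ := Level.IsSkeletal.exists_lift hX S.ι hS (𝟙 X)
  have e : (S.ι.app (op ⟨m⟩)) (s.app (op ⟨m⟩) x) = x := by
    change (s ≫ S.ι).app (op ⟨m⟩) x = x
    rw [hs]; rfl
  have := (s.app (op ⟨m⟩) x).2
  rwa [← e]

theorem IsSkeletal.exists_card_le {n : ℕ} {X : CubicalSet.{u}} (hX : X.IsSkeletal n) {m : ℕ}
    (x : X.cubes m) :
    ∃ D : Finset (Fin m), D.card ≤ n ∧ ∀ i ∉ D, ∀ b, act x (flatten i b) = x := by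
  classical
  obtain ⟨k, hk, z, f, rfl⟩ := hX.exists_act_eq x
  let q (j : Fin k) : Finset (Fin m) := Sum.elim (fun i => {i}) (fun _ => ∅) (f.coord j)
  have hq (j : Fin k) : (q j).card ≤ 1 := by
    simp only [q]; cases f.coord j <;> simp
  refine ⟨Finset.univ.biUnion q, (Finset.card_biUnion_le_card_mul _ _ 1 fun j _ => hq j).trans
    (by simpa using hk), fun i hi b => ?_⟩
  rw [act_act, flatten_comp]
  intro j hj
  refine hi (Finset.mem_biUnion.mpr ⟨j, Finset.mem_univ j, ?_⟩)
  simp only [q]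
  rw [hj]
  simp

theorem act_flatten_self {X : CubicalSet.{u}} {m : ℕ} (i : Fin m) (ι υ : Bool) (x : X.cubes m) :
    act (act x (flatten i υ)) (flatten i ι) = act x (flatten i υ) := by
  rw [act_act, flatten_comp_flatten_self]

theorem act_flatten_comm {X : CubicalSet.{u}} {m : ℕ} ⦃i j : Fin m⦄ (h : i ≠ j) (ι υ : Bool)
    (x : X.cubes m) :
    act (act x (flatten j υ)) (flatten i ι) = act (act x (flatten i ι)) (flatten j υ) := by
  rw [act_act, act_act, flatten_comp_flatten h]

/-- In a `k`-coskeletal cubical set a cube of dimension greater than `k` is determined by its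
faces. -/
theorem IsCoskeletal.ext {k m : ℕ} (hm : k < m) {X : CubicalSet.{u}} (hX : X.IsCoskeletal k)
    {x y : X.cubes m} (h : ∀ i b, act x (flatten i b) = act y (flatten i b)) : x = y := by
  refine uliftYonedaEquiv.symm.injective
    (Level.IsCoskeletal.hom_ext hX _ (isIso_restr_map_boundary_ι hm) ?_)
  refine hom_ext fun l f => ?_
  obtain ⟨⟨f⟩, hf⟩ := f
  obtain ⟨i, b, hi⟩ := not_isProjection_iff.mp hf
  change (f : (⟨l⟩ : CubeCat) ⟶ ⟨m⟩).coord i = Sum.inr b at hi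
  change act x (f : (⟨l⟩ : CubeCat) ⟶ ⟨m⟩) = act y (f : (⟨l⟩ : CubeCat) ⟶ ⟨m⟩)
  rw [← comp_flatten hi, ← act_act, ← act_act, h]

/-- Every `n`-skeletal cubical set is `2n`-coskeletal: spheres of dimension greater than `2n` in it
have unique fillers. -/
theorem IsSkeletal.isCoskeletal {n : ℕ} (hn : 1 ≤ n) {X : CubicalSet.{u}}
    (hX : X.IsSkeletal n) : X.IsCoskeletal (2 * n) := by
  obtain ⟨Y, η, hη, hY⟩ : ∃ (Y : CubicalSet.{u}) (η : X ⟶ Y),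
      IsIso ((level.{u} (2 * n)).restr.map η) ∧ Y.IsCoskeletal (2 * n) :=
    ⟨_, (level.{u} (2 * n)).unit X, inferInstance, Level.isCoskeletal_star _ _⟩
  rw [isIso_restr_map_iff] at hη
  -- The unit `η` from `X` to its coskeleton `Y` is bijective, by induction on the dimension.
  suffices H : ∀ m, Function.Bijective (η.app (op ⟨m⟩)) by
    have := (isIso_iff_bijective η).mpr H
    exact Level.IsCoskeletal.of_iso hY (asIso η)
  intro m
  induction m with
  | zero => exact hη 0 (Nat.zero_le _)
  | succ m ih =>
    by_cases hm : m + 1 ≤ 2 * n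
    · exact hη _ hm
    have hinj : Function.Injective (η.app (op ⟨m + 1⟩)) := by
      intro x x' hxx'
      have hdeg (x : X.cubes (m + 1)) : ∃ i, ∀ b, act x (flatten i b) = x := by
        obtain ⟨D, hD, h⟩ := hX.exists_card_le x
        obtain ⟨i, hi⟩ := Fin.exists_notMem_of_card_lt D (by omega)
        exact ⟨i, h i hi⟩
      refine eq_of_faceOperators_eq (E := fun i b x => act x (flatten i b)) act_flatten_comm
        (fun i b => ?_) (hdeg x) (hdeg x')
      have : act x (face i b) = act x' (face i b) := by
        apply ih.injective
        rw [app_act, app_act, hxx']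
      rw [flatten_eq_degen_comp_face, ← act_act, ← act_act, this]
    refine ⟨hinj, fun y => ?_⟩
    -- Lift the faces of `y` to `X`, and fill the sphere which they form there.
    choose c hc using fun (i : Fin (m + 1)) (b : Bool) => ih.surjective (act y (face i b))
    have hd (i : Fin (m + 1)) (b : Bool) :
        η.app (op ⟨m + 1⟩) (act (c i b) (degen i)) = act y (flatten i b) := by
      rw [app_act, hc, act_act, flatten_eq_degen_comp_face]
    obtain ⟨w, hw⟩ := exists_faceOperators_eq hn (not_le.mp hm)
      (E := fun i b (x : X.cubes (m + 1)) => act x (flatten i b)) act_flatten_self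
      act_flatten_comm hX.exists_card_le (fun i b => act (c i b) (degen i))
      (fun i ι υ => hinj (by rw [app_act, hd, act_flatten_self]))
      (fun i j hij ι υ => hinj (by
        rw [app_act, hd, app_act _ _ (flatten j υ), hd, act_flatten_comm hij]))
    refine ⟨w, hY.ext (not_le.mp hm) fun i b => ?_⟩
    rw [← app_act, hw, hd]

end CubicalSet

/-! ### Two cubes glued to a point along their boundaries -/

namespace CubeCat

theorem hom_zero_ext {m : CubeCat} (f g : m ⟶ ⟨0⟩) : f = g :=
  Hom.ext (funext fun j => j.elim0)

theorem face_coord_succAbove {n : ℕ} (i : Fin (n + 1)) (b : Bool) (j : Fin n) :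
    (face i b).coord (i.succAbove j) = Sum.inl j :=
  Fin.insertNth_apply_succAbove (α := fun _ => Fin n ⊕ Bool) i (Sum.inr b) Sum.inl j

theorem face_coord_of_lt {n : ℕ} {i : Fin (n + 1)} (b : Bool) {j : ℕ} (hj : j < n)
    (h : j < i.val) : (face i b).coord ⟨j, hj.trans n.lt_succ_self⟩ = Sum.inl ⟨j, hj⟩ := by
  rw [← face_coord_succAbove i b, Fin.succAbove_of_castSucc_lt _ _ h]
  rfl

theorem face_coord_of_le {n : ℕ} {i : Fin (n + 1)} (b : Bool) {j : ℕ} (hj : j < n)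
    (h : i.val ≤ j) : (face i b).coord ⟨j + 1, Nat.succ_lt_succ hj⟩ = Sum.inl ⟨j, hj⟩ := by
  rw [← face_coord_succAbove i b, Fin.succAbove_of_le_castSucc _ _ h]
  rfl

/-- A morphism to `I^m` is a projection if its first `n` and its last `n` coordinates are, provided
that these cover all coordinates. -/
theorem IsProjection.of_first_last {l m n : ℕ} (h : n ≤ m) (hm : m ≤ 2 * n)
    {f : (⟨l⟩ : CubeCat) ⟶ ⟨m⟩} (h₁ : IsProjection (f ≫ firstCoords h))
    (h₂ : IsProjection (f ≫ lastCoords h)) : IsProjection f := by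
  rintro ⟨j, hj⟩
  dsimp only at hj
  by_cases hjn : j < n
  · exact h₁ ⟨j, hjn⟩
  · obtain ⟨i, hi⟩ := h₂ ⟨j - (m - n), by dsimp only; omega⟩
    refine ⟨i, ?_⟩
    rw [← hi, comp_coord]
    change _ = f.coord _
    congr 2
    dsimp only
    omega

end CubeCat

namespace CubicalSet

open CubeCat

/-- The `m`-cubes of the cubical set obtained from a point by attaching two `n`-cubes along the
constant maps on their boundaries: the degenerate base point, and for each of the two attached
cubes, distinguished by a Boolean, its degeneracies. -/
inductive TwoCells (n m : ℕ) : Type u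
  | base : TwoCells n m
  | cell (b : Bool) (f : (⟨m⟩ : CubeCat) ⟶ ⟨n⟩) (hf : IsProjection f) : TwoCells n m

namespace TwoCells

variable {l m n : ℕ}

open Classical in
/-- The image of a morphism `f` to `I^n` under the characteristic map of the attached cube `b`. -/
noncomputable def mk (b : Bool) (f : (⟨m⟩ : CubeCat) ⟶ ⟨n⟩) : TwoCells.{u} n m :=
  if hf : IsProjection f then cell b f hf else base

theorem mk_of_isProjection (b : Bool) {f : (⟨m⟩ : CubeCat) ⟶ ⟨n⟩} (hf : IsProjection f) :
    mk.{u} b f = cell b f hf := dif_pos hf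

theorem mk_of_not_isProjection (b : Bool) {f : (⟨m⟩ : CubeCat) ⟶ ⟨n⟩} (hf : ¬ IsProjection f) :
    mk.{u} b f = base := dif_neg hf

/-- The action of the morphisms of cubes. -/
noncomputable def restrict (τ : (⟨l⟩ : CubeCat) ⟶ ⟨m⟩) : TwoCells.{u} n m → TwoCells.{u} n l
  | base => base
  | cell b f _ => mk b (τ ≫ f)

theorem restrict_mk (τ : (⟨l⟩ : CubeCat) ⟶ ⟨m⟩) (b : Bool) (f : (⟨m⟩ : CubeCat) ⟶ ⟨n⟩) :
    restrict τ (mk.{u} b f) = mk b (τ ≫ f) := by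
  by_cases hf : IsProjection f
  · rw [mk_of_isProjection b hf]; rfl
  · rw [mk_of_not_isProjection b hf, mk_of_not_isProjection b fun h => hf h.of_comp]; rfl

open Classical in
/-- The join of two cubes, one of which is meant to be the base point. -/
noncomputable def join (z w : TwoCells.{u} n m) : TwoCells.{u} n m :=
  if z = base then w else z

theorem base_join (w : TwoCells.{u} n m) : join base w = w := if_pos rfl

theorem join_base (z : TwoCells.{u} n m) : join z base = z := by
  by_cases h : z = base
  · rw [h, base_join]
  · exact if_neg h

theorem restrict_join (τ : (⟨l⟩ : CubeCat) ⟶ ⟨m⟩) {z w : TwoCells.{u} n m}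
    (h : z = base ∨ w = base) : restrict τ (join z w) = join (restrict τ z) (restrict τ w) := by
  rcases h with rfl | rfl
  · rw [base_join]; exact (base_join _).symm
  · rw [join_base]; exact (join_base _).symm

end TwoCells

open TwoCells

/-- The cubical set obtained from a point by attaching two `n`-cubes along the constant maps on
their boundaries. -/
noncomputable def twoCells (n : ℕ) : CubicalSet.{u} where
  obj U := TwoCells.{u} n U.unop.dim
  map τ := ↾(restrict τ.unop)
  map_id U := by
    ext z
    cases z with
    | base => rfl
    | cell b f hf =>
      change mk b (𝟙 _ ≫ f) = _
      rw [Category.id_comp, mk_of_isProjection b hf]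
      rfl
  map_comp τ σ := by
    ext z
    cases z with
    | base => rfl
    | cell b f hf =>
      change mk b ((σ.unop ≫ τ.unop) ≫ f) = restrict σ.unop (mk b (τ.unop ≫ f))
      rw [restrict_mk, Category.assoc]

section

variable {l m n : ℕ}

/-- The vertex of `twoCells n`, or one of its degeneracies. -/
abbrev baseCube (n m : ℕ) : (twoCells.{u} n).cubes m := (base : TwoCells.{u} n m)

/-- The image of a morphism to `I^n` in `twoCells n`, under the cube `b`. -/
noncomputable abbrev mkCube (b : Bool) (f : (⟨m⟩ : CubeCat) ⟶ ⟨n⟩) : (twoCells.{u} n).cubes m :=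
  TwoCells.mk b f

theorem act_mkCube (b : Bool) (f : (⟨m⟩ : CubeCat) ⟶ ⟨n⟩) (τ : (⟨l⟩ : CubeCat) ⟶ ⟨m⟩) :
    act (mkCube.{u} b f) τ = mkCube b (τ ≫ f) := restrict_mk τ b f

theorem act_baseCube (τ : (⟨l⟩ : CubeCat) ⟶ ⟨m⟩) :
    act (baseCube.{u} n m) τ = baseCube n l := rfl

theorem act_mkCube_id (b : Bool) (f : (⟨m⟩ : CubeCat) ⟶ ⟨n⟩) :
    act (mkCube.{u} b (𝟙 (⟨n⟩ : CubeCat))) f = mkCube b f := by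
  rw [act_mkCube, Category.comp_id]

theorem eq_baseCube_or_eq_mkCube (z : (twoCells.{u} n).cubes m) :
    z = baseCube n m ∨ ∃ b f, IsProjection f ∧ z = mkCube b f := by
  rcases z with _ | ⟨b, f, hf⟩
  · exact Or.inl rfl
  · exact Or.inr ⟨b, f, hf, (mk_of_isProjection b hf).symm⟩

theorem mkCube_ne_baseCube (b : Bool) {f : (⟨m⟩ : CubeCat) ⟶ ⟨n⟩} (hf : IsProjection f) :
    mkCube.{u} b f ≠ baseCube n m := by
  rw [mkCube, mk_of_isProjection b hf]
  exact fun h => by cases h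

theorem mkCube_eq_baseCube (b : Bool) {f : (⟨m⟩ : CubeCat) ⟶ ⟨n⟩} (hf : ¬ IsProjection f) :
    mkCube.{u} b f = baseCube n m := mk_of_not_isProjection b hf

theorem mkCube_not_ne (b : Bool) {f g : (⟨m⟩ : CubeCat) ⟶ ⟨n⟩} (hg : IsProjection g) :
    mkCube.{u} (!b) f ≠ mkCube b g := by
  by_cases hf : IsProjection f
  · rw [mkCube, mkCube, mk_of_isProjection _ hf, mk_of_isProjection _ hg]
    intro h
    cases b <;> cases h
  · rw [mkCube_eq_baseCube _ hf]
    exact (mkCube_ne_baseCube b hg).symm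

/-- No cube has degeneracies of both attached cubes among its faces. -/
theorem exists_act_ne_mkCube (w : (twoCells.{u} n).cubes m) :
    ∃ b : Bool, ∀ (l : ℕ) (τ : (⟨l⟩ : CubeCat) ⟶ ⟨m⟩) (g : (⟨l⟩ : CubeCat) ⟶ ⟨n⟩),
      IsProjection g → act w τ ≠ mkCube b g := by
  rcases eq_baseCube_or_eq_mkCube w with rfl | ⟨b, f, -, rfl⟩
  · exact ⟨true, fun l τ g hg => (mkCube_ne_baseCube true hg).symm⟩
  · refine ⟨!b, fun l τ g hg => ?_⟩
    rw [act_mkCube, ← Bool.not_not b, Bool.not_not (!b)]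
    exact mkCube_not_ne (!b) hg

theorem eq_baseCube_of_lt (hm : m < n) (z : (twoCells.{u} n).cubes m) : z = baseCube n m := by
  rcases eq_baseCube_or_eq_mkCube z with rfl | ⟨b, f, hf, -⟩
  · rfl
  · exact absurd hf.dim_le (not_le.mpr hm)

theorem isDegenerate_baseCube_iff : IsDegenerate (baseCube.{u} n m) ↔ m ≠ 0 := by
  constructor
  · rintro ⟨k, -, -, hk, -⟩ rfl
    exact Nat.not_lt_zero _ hk
  · exact fun hm => ⟨0, firstCoords (Nat.zero_le m), baseCube n 0, Nat.pos_of_ne_zero hm,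
      (isProjection_firstCoords _).epi, rfl⟩

theorem isDegenerate_mkCube_iff (b : Bool) {f : (⟨m⟩ : CubeCat) ⟶ ⟨n⟩} (hf : IsProjection f) :
    IsDegenerate (mkCube.{u} b f) ↔ m ≠ n := by
  constructor
  · rintro ⟨k, ε, z, hk, -, e⟩ rfl
    rw [eq_baseCube_of_lt hk z] at e
    exact mkCube_ne_baseCube b hf e
  · exact fun hm => ⟨n, f, mkCube b (𝟙 _), lt_of_le_of_ne hf.dim_le hm.symm, hf.epi,
      (act_mkCube_id b f).symm⟩

theorem not_isDegenerate_iff (z : (twoCells.{u} n).cubes m) :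
    ¬ IsDegenerate z ↔ (⟨m, z⟩ : Σ k, (twoCells.{u} n).cubes k) ∈
      ({⟨0, baseCube n 0⟩, ⟨n, mkCube true (𝟙 _)⟩, ⟨n, mkCube false (𝟙 _)⟩} :
        Set (Σ k, (twoCells.{u} n).cubes k)) := by
  simp only [Set.mem_insert_iff, Set.mem_singleton_iff]
  constructor
  · intro hz
    rcases eq_baseCube_or_eq_mkCube z with rfl | ⟨b, f, hf, rfl⟩
    · rw [isDegenerate_baseCube_iff, not_not] at hz
      subst hz
      exact Or.inl rfl
    · rw [isDegenerate_mkCube_iff b hf, not_not] at hz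
      subst hz
      rw [hf.eq_id]
      cases b
      · exact Or.inr (Or.inr rfl)
      · exact Or.inr (Or.inl rfl)
  · rintro (h | h | h) <;> cases h
    · exact fun h => isDegenerate_baseCube_iff.mp h rfl
    · exact fun h => (isDegenerate_mkCube_iff true (isProjection_id _)).mp h rfl
    · exact fun h => (isDegenerate_mkCube_iff false (isProjection_id _)).mp h rfl

/-- Morphisms from `twoCells n` are given by a vertex and two `n`-cubes whose proper faces are
degeneracies of the vertex. -/
theorem exists_hom_twoCells (Z : CubicalSet.{u}) (v : Z.cubes 0) (z : Bool → Z.cubes n)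
    (hz : ∀ (b : Bool) (m : ℕ) (f : (⟨m⟩ : CubeCat) ⟶ ⟨n⟩), ¬ IsProjection f →
      act (z b) f = act v (firstCoords (Nat.zero_le m))) :
    ∃ s : twoCells.{u} n ⟶ Z,
      (∀ m, s.app (op ⟨m⟩) (baseCube n m) = act v (firstCoords (Nat.zero_le m))) ∧
      ∀ (b : Bool) (m : ℕ) (f : (⟨m⟩ : CubeCat) ⟶ ⟨n⟩),
        s.app (op ⟨m⟩) (mkCube b f) = act (z b) f := by
  let s (m : ℕ) : TwoCells.{u} n m → Z.cubes m
    | base => act v (firstCoords (Nat.zero_le m))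
    | cell b f _ => act (z b) f
  have hs (b : Bool) (m : ℕ) (f : (⟨m⟩ : CubeCat) ⟶ ⟨n⟩) : s m (mk b f) = act (z b) f := by
    by_cases hf : IsProjection f
    · rw [mk_of_isProjection b hf]
    · rw [mk_of_not_isProjection b hf, hz b m f hf]
  refine ⟨⟨fun U => ↾(s U.unop.dim), fun U V τ => ?_⟩, fun m => rfl, hs⟩
  ext w
  cases w with
  | base =>
    change act v _ = act (act v _) τ.unop
    rw [act_act]
    exact congrArg _ (hom_zero_ext _ _)
  | cell b f hf =>
    change s _ (mk b (τ.unop ≫ f)) = act (act (z b) f) τ.unop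
    rw [hs, act_act]

theorem isSkeletal_twoCells (n : ℕ) : (twoCells.{u} n).IsSkeletal n := by
  obtain ⟨Z, ε, hε, H⟩ : ∃ (Z : CubicalSet.{u}) (ε : Z ⟶ twoCells.{u} n),
      IsIso ((level.{u} n).restr.map ε) ∧
      ∀ s, s ≫ ε = 𝟙 _ → (level.{u} n).IsSkeletal (twoCells n) :=
    ⟨_, (level.{u} n).counit (twoCells n), inferInstance, Level.isSkeletal_of_section⟩
  rw [isIso_restr_map_iff] at hε
  -- The counit `ε` is bijective in dimensions at most `n`, so the three cubes and the relations
  -- between their faces lift, and they define a section of `ε`.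
  obtain ⟨v, hv⟩ := (hε 0 (Nat.zero_le n)).surjective (baseCube n 0)
  choose z hz using fun b => (hε n le_rfl).surjective (mkCube b (𝟙 _))
  obtain ⟨s, hs, hs'⟩ := exists_hom_twoCells Z v z fun b m f hf => by
    cases n with
    | zero => exact absurd (fun j => j.elim0) hf
    | succ n =>
      obtain ⟨i, c, g, rfl⟩ := exists_comp_face hf
      have : act (z b) (face i c) = act v (firstCoords (Nat.zero_le n)) := by
        apply (hε n n.le_succ).injective
        rw [app_act, app_act, hz, hv, act_mkCube_id, act_baseCube,
          mkCube_eq_baseCube b (not_isProjection_face i c)]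
      rw [← act_act, this, act_act]
      exact congrArg _ (hom_zero_ext _ _)
  refine H s (hom_ext fun m w => ?_)
  rcases eq_baseCube_or_eq_mkCube w with rfl | ⟨b, f, -, rfl⟩
  · change ε.app _ (s.app _ _) = baseCube n m
    rw [hs, app_act, hv]
    rfl
  · change ε.app _ (s.app _ _) = mkCube b f
    rw [hs', app_act, hz, act_mkCube_id]

/-- The faces of the sphere without filler: degeneracies of the two attached cubes. -/
noncomputable def twoCellsSphere (n k : ℕ) (h : n ≤ k) (i : Fin (k + 1)) (_ : Bool) :
    (twoCells.{u} n).cubes k :=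
  if i.val < n then mkCube true (lastCoords h) else mkCube false (firstCoords h)

theorem isSphere_twoCellsSphere {k : ℕ} (h : n ≤ k) (hk : k + 1 = 2 * n) :
    (twoCells.{u} n).IsSphere k (twoCellsSphere n k h) := by
  cases k with
  | zero => trivial
  | succ k =>
    intro i j hij ι υ
    have hij' : i.val ≤ j.val := hij
    simp only [twoCellsSphere, Fin.val_succ, Fin.val_castSucc]
    by_cases hj : j.val + 1 < n
    · have hi : i.val < n := by omega
      rw [if_pos hj, if_pos hi, act_mkCube, act_mkCube]
      congr 1
      apply Hom.ext
      funext t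
      have ht : t.val < n := t.isLt
      have e (i : Fin (k + 1)) (hi : i.val + 1 < n) (ι : Bool) :
          (face i ι ≫ lastCoords h).coord t =
            Sum.inl (⟨k - n + t.val, by omega⟩ : Fin k) := by
        rw [comp_coord_of_inl _ (rfl : (lastCoords h).coord t = Sum.inl _),
          ← face_coord_of_le ι (i := i) (by omega) (by omega)]
        congr 2
        omega
      rw [e i (by omega), e j hj]
    · by_cases hi : i.val < n
      · rw [if_neg hj, if_pos hi, act_mkCube, act_mkCube, mkCube_eq_baseCube,
          mkCube_eq_baseCube]
        · refine not_isProjection_iff.mpr ⟨⟨j.val - (k + 1 - n), ?_⟩, ι, ?_⟩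
          · have := j.isLt
            dsimp only
            omega
          · rw [comp_coord, ← face_coord_self j ι]
            change (face j ι).coord _ = _
            congr 2
            dsimp only
            omega
        · exact not_isProjection_iff.mpr ⟨⟨i.val, hi⟩, υ, face_coord_self i υ⟩
      · rw [if_neg hj, if_neg hi, act_mkCube, act_mkCube]
        congr 1
        apply Hom.ext
        funext t
        have ht : t.val < n := t.isLt
        have e (i : Fin (k + 1)) (hi : n ≤ i.val) (ι : Bool) :
            (face i ι ≫ firstCoords h).coord t = Sum.inl (⟨t.val, by omega⟩ : Fin k) := by
          rw [comp_coord_of_inl _ (rfl : (firstCoords h).coord t = Sum.inl _)]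
          exact face_coord_of_lt ι (by omega) (by omega)
        rw [e i (by omega), e j (by omega)]

theorem not_exists_isFiller {k : ℕ} (h : n ≤ k) (hn : 1 ≤ n) :
    ¬ ∃ w : (twoCells.{u} n).cubes (k + 1), IsFiller (twoCellsSphere n k h) w := by
  rintro ⟨w, hw⟩
  obtain ⟨b, hb⟩ := exists_act_ne_mkCube w
  cases b with
  | true =>
    refine hb _ _ _ (isProjection_lastCoords h) ((hw 0 true).trans (if_pos ?_))
    exact hn
  | false =>
    refine hb _ _ _ (isProjection_firstCoords h) ((hw (Fin.last k) true).trans (if_neg ?_))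
    simpa using h

/-- The sphere without filler, as a morphism from the boundary of `I^(2n)`: on the morphisms with a
constant coordinate, at least one of the projections to the last and to the first `n` coordinates
takes values in the base point. -/
noncomputable def boundaryHom (n : ℕ) : (boundary.{u} (2 * n)).toFunctor ⟶ twoCells.{u} n where
  app U := ↾fun f =>
    join (mk true (f.1.down ≫ lastCoords (by omega))) (mk false (f.1.down ≫ firstCoords (by omega)))
  naturality U V τ := by
    ext f
    obtain ⟨⟨f⟩, hf⟩ := f
    change join (mk true ((τ.unop ≫ f) ≫ _)) (mk false ((τ.unop ≫ f) ≫ _)) =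
      restrict τ.unop (join (mk true (f ≫ _)) (mk false (f ≫ _)))
    rw [restrict_join, restrict_mk, restrict_mk, Category.assoc, Category.assoc]
    by_cases h : IsProjection ((f : (⟨U.unop.dim⟩ : CubeCat) ⟶ ⟨2 * n⟩) ≫
        firstCoords (show n ≤ 2 * n by omega))
    · exact Or.inl (mk_of_not_isProjection _ fun h' =>
        hf (IsProjection.of_first_last _ le_rfl h h'))
    · exact Or.inr (mk_of_not_isProjection _ h)

theorem not_exists_boundary_ι_comp_eq (hn : 1 ≤ n) :
    ¬ ∃ g, (boundary.{u} (2 * n)).ι ≫ g = boundaryHom n := by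
  rintro ⟨g, hg⟩
  have hw (i : Fin (2 * n)) (b : Bool) :
      act (uliftYonedaEquiv g) (flatten i b) =
        (join (n := n) (m := 2 * n)
          (mkCube true (flatten i b ≫ lastCoords (show n ≤ 2 * n by omega)))
          (mkCube false (flatten i b ≫ firstCoords (show n ≤ 2 * n by omega))) :) := by
    have hi : ¬ IsProjection (flatten i b) :=
      not_isProjection_iff.mpr ⟨i, b, flatten_coord_self i b⟩
    have := ConcreteCategory.congr_hom (NatTrans.congr_app hg (op ⟨2 * n⟩)) ⟨⟨flatten i b⟩, hi⟩
    refine Eq.trans ?_ this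
    change _ = g.app (op ⟨2 * n⟩) ⟨flatten i b⟩
    exact uliftYonedaEquiv_naturality g (flatten i b).op |>.trans (by simp [uliftYonedaEquiv_apply])
  -- The first direction is not used by the last `n` coordinates, the last one not by the first `n`.
  -- So `g` has degeneracies of both attached cubes among its faces.
  obtain ⟨b, hb⟩ := exists_act_ne_mkCube (uliftYonedaEquiv g)
  cases b with
  | true =>
    let i : Fin (2 * n) := ⟨0, by omega⟩
    refine hb _ (flatten i true) (lastCoords (by omega)) (isProjection_lastCoords _) ?_
    rw [hw, flatten_comp (f := lastCoords _), mkCube_eq_baseCube false]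
    · exact join_base _
    · exact not_isProjection_iff.mpr ⟨⟨0, hn⟩, true, flatten_coord_self i true⟩
    · intro j hj
      have := congrArg Fin.val (Sum.inl_injective hj)
      simp [i] at this
      omega
  | false =>
    let i : Fin (2 * n) := ⟨2 * n - 1, by omega⟩
    refine hb _ (flatten i true) (firstCoords (by omega)) (isProjection_firstCoords _) ?_
    rw [hw, flatten_comp (f := firstCoords _), mkCube_eq_baseCube true]
    · exact base_join _
    · refine not_isProjection_iff.mpr ⟨⟨n - 1, by dsimp only; omega⟩, true, ?_⟩
      rw [← flatten_coord_self i true, comp_coord]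
      change (flatten i true).coord _ = _
      congr 2
      dsimp only
      omega
    · intro j hj
      have := congrArg Fin.val (Sum.inl_injective hj)
      simp [i] at this
      have := j.isLt
      dsimp only at this
      omega

/-- If `twoCells n` is coskeletal for a level, then this level does not invert the inclusion of the
boundary of `I^(2n)`. -/
theorem not_isIso_restr_map_boundary_ι (hn : 1 ≤ n) {L : Level CubicalSet.{u}}
    (hL : L.IsCoskeletal (twoCells.{u} n)) : ¬ IsIso (L.restr.map (boundary.{u} (2 * n)).ι) :=
  fun h => not_exists_boundary_ι_comp_eq hn (hL.exists_extension _ h _)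

end

/-! ### The Aufhebung -/

theorem level_isLower_level {m n : ℕ} (h : m ≤ n) :
    (level.{u} m).IsLower (level.{u} n) :=
  Level.isLower_of_inverts fun _ _ f hf =>
    (isIso_restr_map_iff m f).mpr fun k hk => (isIso_restr_map_iff n f).mp hf k (hk.trans h)

theorem level_isWayBelow_level {n : ℕ} (hn : 1 ≤ n) :
    (level.{u} n).IsWayBelow (level.{u} (2 * n)) :=
  ⟨level_isLower_level (by omega), Level.exists_comp_star_iso _ fun C =>
    IsSkeletal.isCoskeletal hn (Level.isSkeletal_shriek _ C)⟩

/-- If the cube `I^m` is skeletal for a level, then so are the cubes of smaller dimension, which are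
retracts of it, and the level `m` is lower. -/
theorem level_isLower_of_isSkeletal {m : ℕ} {L : Level CubicalSet.{u}}
    (h : L.IsSkeletal (uliftYoneda.{u}.obj (⟨m⟩ : CubeCat))) : (level.{u} m).IsLower L := by
  refine Level.isLower_of_inverts fun X Y f hf => (isIso_restr_map_iff m f).mpr fun k hk => ?_
  obtain ⟨s, hs⟩ := (isProjection_firstCoords hk).exists_section
  have hk : L.IsSkeletal (uliftYoneda.{u}.obj (⟨k⟩ : CubeCat)) :=
    h.of_retract (uliftYoneda.map s) (uliftYoneda.map (firstCoords hk))
      (by rw [← Functor.map_comp, hs, CategoryTheory.Functor.map_id])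
  constructor
  · intro x y hxy
    refine uliftYonedaEquiv.symm.injective (hk.hom_ext f hf ?_)
    rw [uliftYonedaEquiv_symm_comp, uliftYonedaEquiv_symm_comp, hxy]
  · intro y
    obtain ⟨g, hg⟩ := hk.exists_lift f hf (uliftYonedaEquiv.symm y)
    exact ⟨uliftYonedaEquiv g, by rw [← uliftYonedaEquiv_comp, hg, Equiv.apply_symm_apply]⟩

/-- For every level, either the cube `I^m` is skeletal, or the level inverts the inclusion of its
boundary: the image of the skeleton of `I^m` in `I^m` is either everything or contained in the
boundary. -/
theorem isSkeletal_or_isIso_restr_map_boundary_ι (L : Level CubicalSet.{u}) (m : ℕ) :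
    L.IsSkeletal (uliftYoneda.{u}.obj (⟨m⟩ : CubeCat)) ∨
      IsIso (L.restr.map (boundary.{u} m).ι) := by
  by_cases h : ∀ (k : ℕ)
      (w : (L.shriek.obj (L.restr.obj (uliftYoneda.{u}.obj ⟨m⟩))).obj (op ⟨k⟩)),
      ¬ IsProjection ((L.counit (uliftYoneda.{u}.obj (⟨m⟩ : CubeCat))).app (op ⟨k⟩) w).down
  · right
    -- The counit becomes invertible and factors through the inclusion of the boundary, which thus
    -- becomes a split epimorphism; it remains a monomorphism since `i^*` is a right adjoint.
    let l := Subfunctor.lift (G := boundary.{u} m) (L.counit (uliftYoneda.{u}.obj ⟨m⟩)) (by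
      rintro ⟨⟨k⟩⟩ _ ⟨w, rfl⟩
      exact h k w)
    have hl : l ≫ (boundary.{u} m).ι = L.counit _ := Subfunctor.lift_ι _ _
    have hs : IsSplitEpi (L.restr.map (boundary.{u} m).ι) := by
      refine ⟨⟨⟨inv (L.restr.map (L.counit _)) ≫ L.restr.map l, ?_⟩⟩⟩
      rw [Category.assoc, ← Functor.map_comp, hl, IsIso.inv_hom_id]
    have : L.restr.PreservesMonomorphisms :=
      Functor.preservesMonomorphisms_of_adjunction L.adjShriek
    exact isIso_of_mono_of_isSplitEpi _
  · left
    push Not at h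
    obtain ⟨k, w, hw⟩ := h
    -- A section of the projection moves `w` to a cube over the identity of `I^m`.
    obtain ⟨s, hs⟩ := hw.exists_section
    refine Level.isSkeletal_of_section (uliftYonedaEquiv.symm (act w s))
      (uliftYonedaEquiv.injective ?_)
    rw [uliftYonedaEquiv_comp, Equiv.apply_symm_apply, app_act]
    exact ULift.ext _ _ hs

theorem isAufhebung_level {n : ℕ} (hn : 1 ≤ n) :
    (level.{u} n).IsAufhebung (level.{u} (2 * n)) := by
  refine ⟨level_isWayBelow_level hn, fun L hL => level_isLower_of_isSkeletal ?_⟩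
  refine (isSkeletal_or_isIso_restr_map_boundary_ι L (2 * n)).resolve_right ?_
  exact not_isIso_restr_map_boundary_ι hn (hL.isCoskeletal (isSkeletal_twoCells n))

end CubicalSet

theorem mainTheorem2 (n : ℕ) (hn : 1 ≤ n) :
    -- the Aufhebung of level `n` is level `2n`, in the lattice of all levels
    (CubicalSet.level.{u} n).IsAufhebung (CubicalSet.level.{u} (2 * n)) ∧
    -- the upper bound
    (∀ X : CubicalSet.{u}, X.IsSkeletal n → X.IsCoskeletal (2 * n)) ∧
    -- sharpness: a cubical set with one vertex `v` and two further nondegenerate cubes `x`, `y` of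
    -- dimension `n`, and a `2n`-sphere in it without a filler
    (∃ (X : CubicalSet.{u}) (v : X.cubes 0) (x y : X.cubes n),
      X.IsSkeletal n ∧ ¬ X.IsCoskeletal (2 * n - 1) ∧ x ≠ y ∧
      (∀ (m : ℕ) (z : X.cubes m), ¬ CubicalSet.IsDegenerate z ↔
        (⟨m, z⟩ : Σ k, X.cubes k) ∈
          ({⟨0, v⟩, ⟨n, x⟩, ⟨n, y⟩} : Set (Σ k, X.cubes k))) ∧
      (∀ (m : ℕ) (_ : m < n) (τ : (⟨m⟩ : CubeCat) ⟶ ⟨n⟩),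
        CubicalSet.act x τ = CubicalSet.act v (CubeCat.firstCoords (Nat.zero_le m)) ∧
        CubicalSet.act y τ = CubicalSet.act v (CubeCat.firstCoords (Nat.zero_le m))) ∧
      ∃ c : Fin (2 * n - 1 + 1) → Bool → X.cubes (2 * n - 1),
        (∀ (i : Fin (2 * n - 1 + 1)) (ι : Bool), c i ι =
          if i.val < n then
            CubicalSet.act x (CubeCat.lastCoords (show n ≤ 2 * n - 1 by omega))
          else CubicalSet.act y (CubeCat.firstCoords (show n ≤ 2 * n - 1 by omega))) ∧
        X.IsSphere (2 * n - 1) c ∧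
        ¬ ∃ w : X.cubes (2 * n - 1 + 1), CubicalSet.IsFiller c w) := by
  refine ⟨CubicalSet.isAufhebung_level hn, fun X hX => hX.isCoskeletal hn,
    CubicalSet.twoCells n, CubicalSet.baseCube n 0, CubicalSet.mkCube true (𝟙 _),
    CubicalSet.mkCube false (𝟙 _), CubicalSet.isSkeletal_twoCells n,
    fun h => CubicalSet.not_isIso_restr_map_boundary_ι hn h
      (CubicalSet.isIso_restr_map_boundary_ι (by omega)),
    CubicalSet.mkCube_not_ne false (CubeCat.isProjection_id _),
    fun m z => CubicalSet.not_isDegenerate_iff z, fun m hm τ => ?_,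
    CubicalSet.twoCellsSphere n (2 * n - 1) (by omega), fun i ι => ?_,
    CubicalSet.isSphere_twoCellsSphere _ (by omega), CubicalSet.not_exists_isFiller _ hn⟩
  · exact ⟨CubicalSet.eq_baseCube_of_lt hm _, CubicalSet.eq_baseCube_of_lt hm _⟩
  · rw [CubicalSet.act_mkCube_id, CubicalSet.act_mkCube_id]
    rfl
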